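/- Let $w:\mathbb{R}\to\mathbb{R}$ be bounded, non-negative, integrable with $\int_{\mathbb{R}} w=1$, and symmetric decreasing, i.e. even and non-increasing on the positive half line. Let $h_f,h_g:[0,1]\to[0,1]$ be non-decreasing with $h_f(0)=h_g(0)=0$ and $h_f(1)=h_g(1)=1$; write $h^{-1}(u)=\inf\{v\in[0,1]: h(v)\ge u\}$ for the generalized inverse, and assume $\int_0^1\big(h_g^{-1}(u)-h_f(u)\big)\,du=0$. Fix $\epsilon>0$ and let $f,g:\mathbb{R}\to[0,1]$ be Lebesgue measurable functions such that for $p\in\{f,g\}$ $$\lim_{x\to-\infty}|x|^{1+\epsilon}p(x)=0,\qquad \lim_{x\to+\infty}|x|^{1+\epsilon}(p(x)-1)=0 .$$ For such $p$ and $0<t<1$, the level set $E_t=\{x: p(x)>t\}$ is the disjoint union of a bounded set $A_t$ and a half line $]a_t,+\infty[$; put $\bar E_t=\,]a_t-|A_t|,+\infty[$, where $|\cdot|$ is Lebesgue measure, put $\bar E_t=\emptyset$ for $t\ge 1$, and define the increasing rearrangement of $p$ by $\bar p(x)=\int_0^{\infty}\mathbf{1}_{\bar E_t}(x)\,dt$.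 For measurable $f,g:\mathbb{R}\to[0,1]$ let $$\mathcal{W}(f,g)=\int_{\mathbb{R}}\Big\{\int_0^{g(x)}h_g^{-1}(u)\,du+\int_0^{f(x)}h_f^{-1}(v)\,dv-f(x)\,(g\otimes w)(x)\Big\}\,dx ,$$ where $(g\otimes w)(x)=\int_{\mathbb{R}}g(y)w(x-y)\,dy$. Then the negative parts of the integrands defining $\mathcal{W}(f,g)$ and $\mathcal{W}(\bar f,\bar g)$ have finite integral, so that both potentials are well defined in $]-\infty,+\infty]$, and $$\mathcal{W}(f,g)\ \ge\ \mathcal{W}(\bar f,\bar g).$$ -/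

import Mathlib

open MeasureTheory Set Filter Topology

namespace SpatialCoupling

noncomputable section

/-- An averaging window: bounded, non-negative, even, integrable, with integral one. -/
structure IsWindow (w : ℝ → ℝ) : Prop where
  bounded : ∃ C : ℝ, ∀ x, w x ≤ C
  nonneg : ∀ x, 0 ≤ w x
  even : ∀ x, w (-x) = w x
  integrable : Integrable w volume
  integral_eq_one : ∫ x, w x = 1

/-- Symmetric decreasing: even, and non-increasing on the positive half line.
The value at the origin is left free. -/
def SymmetricDecreasing (w : ℝ → ℝ) : Prop :=
  (∀ x, w (-x) = w x) ∧ AntitoneOn w (Ioi 0)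

/-- An update function: a non-decreasing map from `[0,1]` to `[0,1]` with `h 0 = 0`, `h 1 = 1`.
Continuity and strict monotonicity are not required; values off `[0,1]` play no role. -/
structure IsUpdateFunction (h : ℝ → ℝ) : Prop where
  monotoneOn : MonotoneOn h (Icc 0 1)
  mapsTo : MapsTo h (Icc 0 1) (Icc 0 1)
  map_zero : h 0 = 0
  map_one : h 1 = 1

/-- The generalized inverse of an update function, `h⁻¹(u) = inf {v ∈ [0,1] | u ≤ h v}`. -/
def genInv (h : ℝ → ℝ) (u : ℝ) : ℝ :=
  sInf {v : ℝ | v ∈ Icc (0 : ℝ) 1 ∧ u ≤ h v}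

/-- The signed area `A(h_f, h_g; u)` between the two curves. -/
def signedArea (hf hg : ℝ → ℝ) (u : ℝ) : ℝ :=
  ∫ u' in (0 : ℝ)..u, (genInv hg u' - hf u')

/-- The space of profiles: (Lebesgue) measurable functions from `ℝ` to `[0,1]` that approach
`0` at `-∞` and `1` at `+∞` faster than `|x| ^ (-(1 + ε))`. -/
def profileSpace (ε : ℝ) : Set (ℝ → ℝ) :=
  {p | AEMeasurable p volume ∧ (∀ x, p x ∈ Icc (0 : ℝ) 1) ∧
    Tendsto (fun x : ℝ => |x| ^ (1 + ε) * p x) atBot (𝓝 0) ∧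
    Tendsto (fun x : ℝ => |x| ^ (1 + ε) * (p x - 1)) atTop (𝓝 0)}

/-- The level set `E_t = {x | p x > t}`. -/
def levelSet (p : ℝ → ℝ) (t : ℝ) : Set ℝ := {x | t < p x}

/-- The rearranged level set `]a - |A|, +∞[`, where `E_t` is the disjoint union of a bounded set
`A` and a half line `]a, +∞[` (the point `a - |A|` does not depend on the decomposition).
It is empty when there is no such decomposition, in particular when `E_t` is empty. -/
def rearrangedLevelSet (p : ℝ → ℝ) (t : ℝ) : Set ℝ :=
  {x | ∃ (A : Set ℝ) (a : ℝ), Bornology.IsBounded A ∧ Disjoint A (Ioi a) ∧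
    levelSet p t = A ∪ Ioi a ∧ a - (volume A).toReal < x}

/-- The increasing rearrangement, in layer cake form. -/
def increasingRearrangement (p : ℝ → ℝ) (x : ℝ) : ℝ :=
  ∫ t in Ioi (0 : ℝ), (rearrangedLevelSet p t).indicator (fun _ => (1 : ℝ)) x

/-- The convolution `p ⊗ w`. -/
def conv (p w : ℝ → ℝ) : ℝ → ℝ :=
  convolution p w (ContinuousLinearMap.mul ℝ ℝ) volume

/-- The single-system term `I_{f,g}(x) = ∫₀^{g(x)} h_g⁻¹ + ∫₀^{f(x)} h_f⁻¹`. -/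
def singleTerm (hf hg f g : ℝ → ℝ) (x : ℝ) : ℝ :=
  (∫ u in (0 : ℝ)..(g x), genInv hg u) + ∫ v in (0 : ℝ)..(f x), genInv hf v

/-- The integrand `I_{f,g}(x) - f(x) g^w(x)` of the potential. -/
def potentialIntegrand (hf hg w f g : ℝ → ℝ) (x : ℝ) : ℝ :=
  singleTerm hf hg f g x - f x * conv g w x

/-- The integral of the positive part of the integrand. -/
def potentialPos (hf hg w f g : ℝ → ℝ) : ENNReal :=
  ∫⁻ x, ENNReal.ofReal (potentialIntegrand hf hg w f g x)

/-- The integral of the negative part of the integrand. -/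
def potentialNeg (hf hg w f g : ℝ → ℝ) : ENNReal :=
  ∫⁻ x, ENNReal.ofReal (-potentialIntegrand hf hg w f g x)

/-- The potential `W(f,g)`, the Lebesgue integral of the integrand as an extended real number.
It is a meaningful element of `]-∞, +∞]` as soon as `potentialNeg` is finite. -/
def potential (hf hg w f g : ℝ → ℝ) : EReal :=
  (potentialPos hf hg w f g : EReal) - (potentialNeg hf hg w f g : EReal)

end

end SpatialCoupling

open SpatialCoupling

namespace SpatialCoupling

noncomputable section

/-! The potential splits into a term that rearrangement preserves and a non-negative term that it
cannot increase. By `IsUpdateFunction.integral_genInv`, the area hypothesis says that the integrals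
of the two generalized inverses over `[0,1]` add up to one. Hence the integrand equals `localPart +
interaction` (`potentialIntegrand_eq`), where `interaction = f * (1 - conv g w)` and the local part
is integrable.

Both terms are read off from level sets. Relative to the unit step, a level set has a finite signed
length for almost every level; minus this length is its depth, which is the end point of the
rearranged half line. The integral of the local part involves only the depths
(`IsLayered.integral_relativePrimitive`), so it is unchanged.

For the interaction, Tonelli reduces matters to `∫ f(x) (1 - g(x - z)) dx` for a fixed shift `z`,
and the layer cake formula to the measure of a level set of `f` outside a translated level set of
`g`. With depths `a` and `b`, this measure is at least the positive part of `b + z - a`, because a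
set difference is at least as large as the difference of the lengths
(`ofReal_layerDepth_le_volume`). Half lines are nested and attain the bound
(`volume_halfLine_shift`). Integrating over levels and against `w ≥ 0` concludes. -/

/-! ### Layers, depths and relative primitives. -/

/-- Lebesgue measure on the unit interval of levels. -/
def levelMeasure : Measure ℝ := volume.restrict (Ioo 0 1)

instance : IsProbabilityMeasure levelMeasure := ⟨by simp [levelMeasure]⟩

/-- The unit step at the origin. -/
def unitStep (x : ℝ) : ℝ := (Ioi (0 : ℝ)).indicator (fun _ => 1) x

lemma measurable_unitStep : Measurable unitStep :=
  measurable_const.indicator measurableSet_Ioi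

/-- The indicator of a set of pairs (level, position), relative to the unit step. -/
def layer (E : Set (ℝ × ℝ)) (z : ℝ × ℝ) : ℝ := E.indicator (fun _ => 1) z - unitStep z.2

/-- Minus the signed length of a layer: it is `a` for the half line `]a, +∞[`. -/
def layerDepth (E : Set (ℝ × ℝ)) (t : ℝ) : ℝ := -∫ x, layer E (t, x)

/-- The set `E` of pairs `(t, x)` describes, up to null sets, the level sets `{x | t < p x}`, and
`p` is an integrable perturbation of the unit step. -/
structure IsLayered (E : Set (ℝ × ℝ)) (p : ℝ → ℝ) : Prop where
  measurableSet : MeasurableSet E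
  mem_iff : ∀ᵐ x, ∀ᵐ t ∂levelMeasure, ((t, x) ∈ E ↔ t < p x)
  mem_Icc : ∀ x, p x ∈ Icc (0 : ℝ) 1
  integrable : Integrable (layer E) (levelMeasure.prod volume)

/-- The primitive of `k` at `p`, relative to the unit step. -/
def relativePrimitive (k p : ℝ → ℝ) (x : ℝ) : ℝ :=
  (∫ u in (0 : ℝ)..p x, k u) - (∫ u in (0 : ℝ)..1, k u) * unitStep x

lemma measurable_layer {E : Set (ℝ × ℝ)} (hE : MeasurableSet E) : Measurable (layer E) :=
  (measurable_const.indicator hE).sub (measurable_unitStep.comp measurable_snd)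

lemma measurable_layerDepth {E : Set (ℝ × ℝ)} (hE : MeasurableSet E) :
    Measurable (layerDepth E) := by
  have h : StronglyMeasurable (Function.uncurry fun t x => layer E (t, x)) :=
    (measurable_layer hE).stronglyMeasurable
  exact h.integral_prod_right.measurable.neg

lemma intervalIntegral_eq_integral_levelMeasure (k : ℝ → ℝ) {q : ℝ} (hq : q ∈ Icc (0 : ℝ) 1) :
    ∫ u in (0 : ℝ)..q, k u = ∫ t, (Iio q).indicator k t ∂levelMeasure := by
  rw [intervalIntegral.integral_of_le hq.1, integral_Ioc_eq_integral_Ioo,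
    integral_indicator measurableSet_Iio, levelMeasure, Measure.restrict_restrict measurableSet_Iio]
  congr 2
  ext t
  simp only [mem_Ioo, mem_inter_iff, mem_Iio]
  exact ⟨fun h => ⟨h.2, h.1, h.2.trans_le hq.2⟩, fun h => ⟨h.2.1, h.1⟩⟩

lemma intervalIntegral_one_eq_integral_levelMeasure (k : ℝ → ℝ) :
    ∫ u in (0 : ℝ)..1, k u = ∫ t, k t ∂levelMeasure := by
  rw [intervalIntegral.integral_of_le zero_le_one, integral_Ioc_eq_integral_Ioo, levelMeasure]

/-- Both primitives are integrals of `k` over all levels, weighted by the indicator of `t < p x` and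
by the unit step; the difference of the weights is the layer. -/
lemma IsLayered.relativePrimitive_ae_eq {E : Set (ℝ × ℝ)} {p k : ℝ → ℝ} (h : IsLayered E p)
    (hk : Integrable k levelMeasure) :
    relativePrimitive k p =ᵐ[volume] fun x => ∫ t, k t * layer E (t, x) ∂levelMeasure := by
  filter_upwards [h.mem_iff] with x hx
  rw [relativePrimitive, intervalIntegral_eq_integral_levelMeasure k (h.mem_Icc x),
    intervalIntegral_one_eq_integral_levelMeasure, ← integral_mul_const,
    ← integral_sub (hk.indicator measurableSet_Iio) (hk.mul_const _)]
  refine integral_congr_ae ?_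
  filter_upwards [hx] with t ht
  by_cases htp : t < p x
  · simp [layer, ht.2 htp, htp]; ring
  · simp [layer, mt ht.1 htp, htp]

lemma IsLayered.integrable_mul_layer {E : Set (ℝ × ℝ)} {p k : ℝ → ℝ} (h : IsLayered E p)
    (hk : AEStronglyMeasurable k levelMeasure) {C : ℝ} (hC : ∀ᵐ t ∂levelMeasure, ‖k t‖ ≤ C) :
    Integrable (fun z : ℝ × ℝ => k z.1 * layer E z) (levelMeasure.prod volume) :=
  h.integrable.bdd_mul hk.comp_fst (Measure.quasiMeasurePreserving_fst.ae hC)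

lemma IsLayered.integrable_relativePrimitive {E : Set (ℝ × ℝ)} {p k : ℝ → ℝ} (h : IsLayered E p)
    (hk : AEStronglyMeasurable k levelMeasure) {C : ℝ} (hC : ∀ᵐ t ∂levelMeasure, ‖k t‖ ≤ C) :
    Integrable (relativePrimitive k p) :=
  (h.integrable_mul_layer hk hC).integral_prod_right.congr
    (h.relativePrimitive_ae_eq (Integrable.of_bound hk C hC)).symm

/-- The integral of a relative primitive depends only on the depths of the layers. -/
lemma IsLayered.integral_relativePrimitive {E : Set (ℝ × ℝ)} {p k : ℝ → ℝ} (h : IsLayered E p)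
    (hk : AEStronglyMeasurable k levelMeasure) {C : ℝ} (hC : ∀ᵐ t ∂levelMeasure, ‖k t‖ ≤ C) :
    ∫ x, relativePrimitive k p x = -∫ t, k t * layerDepth E t ∂levelMeasure := by
  rw [integral_congr_ae (h.relativePrimitive_ae_eq (Integrable.of_bound hk C hC)),
    ← integral_integral_swap (h.integrable_mul_layer hk hC), ← integral_neg]
  refine integral_congr_ae (Eventually.of_forall fun t => ?_)
  simp [layerDepth, integral_const_mul]

lemma IsLayered.aemeasurable {E : Set (ℝ × ℝ)} {p : ℝ → ℝ} (h : IsLayered E p) :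
    AEMeasurable p := by
  -- For `k = 1` the relative primitive is `p - unitStep`.
  have h1 := (h.integrable_relativePrimitive (k := fun _ => 1) aestronglyMeasurable_const
    (C := 1) (by simp)).aestronglyMeasurable.aemeasurable.add measurable_unitStep.aemeasurable
  refine h1.congr (Eventually.of_forall fun x => ?_)
  simp [relativePrimitive]

/-! ### Layer cake formulas. -/

lemma IsLayered.ofReal_ae_eq {E : Set (ℝ × ℝ)} {p : ℝ → ℝ} (h : IsLayered E p) :
    ∀ᵐ x, ENNReal.ofReal (p x) =
      ∫⁻ t, E.indicator (fun _ => (1 : ENNReal)) (t, x) ∂levelMeasure := by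
  filter_upwards [h.mem_iff] with x hx
  have : ∫⁻ t, E.indicator (fun _ => (1 : ENNReal)) (t, x) ∂levelMeasure =
      ∫⁻ t, (Iio (p x)).indicator (fun _ => (1 : ENNReal)) t ∂levelMeasure := by
    refine lintegral_congr_ae ?_
    filter_upwards [hx] with t ht
    simp only [indicator, ht, mem_Iio]
  rw [this, lintegral_indicator measurableSet_Iio, levelMeasure,
    Measure.restrict_restrict measurableSet_Iio]
  have h2 : Iio (p x) ∩ Ioo 0 1 = Ioo 0 (p x) := by
    ext t
    simp only [mem_Ioo, mem_inter_iff, mem_Iio]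
    exact ⟨fun h => ⟨h.2.1, h.1⟩, fun h' => ⟨h'.2, h'.1, h'.2.trans_le (h.mem_Icc x).2⟩⟩
  simp [h2]

lemma IsLayered.ofReal_one_sub_ae_eq {E : Set (ℝ × ℝ)} {p : ℝ → ℝ} (h : IsLayered E p) :
    ∀ᵐ x, ENNReal.ofReal (1 - p x) =
      ∫⁻ t, Eᶜ.indicator (fun _ => (1 : ENNReal)) (t, x) ∂levelMeasure := by
  filter_upwards [h.mem_iff] with x hx
  have : ∫⁻ t, Eᶜ.indicator (fun _ => (1 : ENNReal)) (t, x) ∂levelMeasure =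
      ∫⁻ t, (Ici (p x)).indicator (fun _ => (1 : ENNReal)) t ∂levelMeasure := by
    refine lintegral_congr_ae ?_
    filter_upwards [hx] with t ht
    simp only [indicator, mem_compl_iff, ht, mem_Ici, not_lt]
  have hne : ∀ᵐ t ∂(volume : Measure ℝ), t ≠ p x := by simp [ae_iff]
  rw [this, lintegral_indicator measurableSet_Ici, levelMeasure,
    Measure.restrict_restrict measurableSet_Ici]
  have h2 : (Ici (p x) ∩ Ioo 0 1 : Set ℝ) =ᵐ[volume] Ioo (p x) 1 := by
    filter_upwards [hne] with t ht
    have := (h.mem_Icc x).1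
    simp only [eq_iff_iff]
    change (t ∈ Ici (p x) ∩ Ioo 0 1) ↔ t ∈ Ioo (p x) 1
    simp only [mem_Ioo, mem_inter_iff, mem_Ici]
    exact ⟨fun h => ⟨lt_of_le_of_ne h.1 ht.symm, h.2.2⟩,
      fun h' => ⟨h'.1.le, this.trans_lt h'.1, h'.2⟩⟩
  rw [setLIntegral_const, one_mul, measure_congr h2, Real.volume_Ioo]

/-- Layer cake formula for the interaction of a profile with a shifted complementary profile. -/
lemma lintegral_mul_one_sub_shift {E F : Set (ℝ × ℝ)} {p q : ℝ → ℝ} (hE : IsLayered E p)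
    (hF : IsLayered F q) (z : ℝ) :
    ∫⁻ x, ENNReal.ofReal (p x) * ENNReal.ofReal (1 - q (x - z)) =
      ∫⁻ t, ∫⁻ s, volume {x | (t, x) ∈ E ∧ (s, x - z) ∉ F} ∂levelMeasure ∂levelMeasure := by
  have hq : ∀ᵐ x, ENNReal.ofReal (1 - q (x - z)) =
      ∫⁻ s, Fᶜ.indicator (fun _ => (1 : ENNReal)) (s, x - z) ∂levelMeasure :=
    (measurePreserving_sub_right volume z).quasiMeasurePreserving.ae hF.ofReal_one_sub_ae_eq
  have hEm : Measurable (E.indicator (fun _ => (1 : ENNReal))) :=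
    measurable_const.indicator hE.measurableSet
  have hFm : Measurable (Fᶜ.indicator (fun _ => (1 : ENNReal))) :=
    measurable_const.indicator hF.measurableSet.compl
  have hcm : Measurable fun x =>
      ∫⁻ s, Fᶜ.indicator (fun _ => (1 : ENNReal)) (s, x - z) ∂levelMeasure := by
    have h : Measurable fun x : ℝ × ℝ => Fᶜ.indicator (fun _ => (1 : ENNReal)) (x.2, x.1 - z) :=
      hFm.comp (by fun_prop)
    exact h.lintegral_prod_right'
  calc _ = ∫⁻ x, ∫⁻ t, E.indicator (fun _ => (1 : ENNReal)) (t, x) *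
        ∫⁻ s, Fᶜ.indicator (fun _ => (1 : ENNReal)) (s, x - z) ∂levelMeasure ∂levelMeasure := by
        refine lintegral_congr_ae ?_
        filter_upwards [hE.ofReal_ae_eq, hq] with x h1 h2
        rw [h1, h2, ← lintegral_mul_const _
          (show Measurable fun t => E.indicator (fun _ => (1 : ENNReal)) (t, x) from
            hEm.comp (by fun_prop))]
    _ = ∫⁻ t, ∫⁻ x, ∫⁻ s, E.indicator (fun _ => (1 : ENNReal)) (t, x) *
        Fᶜ.indicator (fun _ => (1 : ENNReal)) (s, x - z) ∂levelMeasure ∂volume ∂levelMeasure := by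
        rw [lintegral_lintegral_swap]
        · refine lintegral_congr fun t => lintegral_congr fun x => ?_
          rw [lintegral_const_mul _
            (show Measurable fun s => Fᶜ.indicator (fun _ => (1 : ENNReal)) (s, x - z) from
              hFm.comp (by fun_prop))]
        · exact ((hEm.comp measurable_swap).mul (hcm.comp measurable_fst)).aemeasurable
    _ = _ := by
        refine lintegral_congr fun t => ?_
        rw [lintegral_lintegral_swap]
        · refine lintegral_congr fun s => ?_
          have hm : MeasurableSet {x | (t, x) ∈ E ∧ (s, x - z) ∉ F} :=
            (measurable_prodMk_left hE.measurableSet).inter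
              ((show Measurable fun x : ℝ => (s, x - z) by fun_prop) hF.measurableSet.compl)
          rw [← lintegral_indicator_one hm]
          refine lintegral_congr fun x => ?_
          by_cases h1 : (t, x) ∈ E <;> by_cases h2 : (s, x - z) ∈ F <;> simp [h1, h2]
        · exact ((hEm.comp (show Measurable fun x : ℝ × ℝ => (t, x.1) by fun_prop)).mul
            (hFm.comp (show Measurable fun x : ℝ × ℝ => (x.2, x.1 - z) by fun_prop))).aemeasurable

/-! ### Translated steps and the lower bound by depths. -/

lemma unitStep_shift_eq (a x : ℝ) : unitStep (x - a) = (Ioi a).indicator (fun _ => 1) x := by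
  simp [unitStep, indicator]

lemma unitStep_shift_sub (a x : ℝ) : unitStep (x - a) - unitStep x =
    (Ioc a 0).indicator (fun _ => 1) x - (Ioc 0 a).indicator (fun _ => 1) x := by
  simp only [unitStep, indicator, mem_Ioi, mem_Ioc, sub_pos]
  split_ifs <;> grind

lemma integrable_unitStep_shift_sub (a : ℝ) :
    Integrable fun x => unitStep (x - a) - unitStep x := by
  simp only [unitStep_shift_sub]
  exact ((integrable_indicator_iff measurableSet_Ioc).2 (by simp)).sub
    ((integrable_indicator_iff measurableSet_Ioc).2 (by simp))

lemma integral_unitStep_shift_sub (a : ℝ) :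
    ∫ x, (unitStep (x - a) - unitStep x) = -a := by
  simp only [unitStep_shift_sub]
  rw [integral_sub ((integrable_indicator_iff measurableSet_Ioc).2 (by simp))
    ((integrable_indicator_iff measurableSet_Ioc).2 (by simp)),
    integral_indicator_const _ measurableSet_Ioc, integral_indicator_const _ measurableSet_Ioc]
  rcases le_total a 0 with h | h <;> simp [h]

lemma integral_abs_unitStep_shift_sub (a : ℝ) :
    ∫ x, ‖unitStep (x - a) - unitStep x‖ = |a| := by
  have : ∀ x, ‖unitStep (x - a) - unitStep x‖ =
      (Ioc a 0).indicator (fun _ => 1) x + (Ioc 0 a).indicator (fun _ => 1) x := by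
    intro x
    rw [unitStep_shift_sub]
    simp only [indicator, mem_Ioc, Real.norm_eq_abs]
    split_ifs <;> grind
  simp only [this]
  rw [integral_add ((integrable_indicator_iff measurableSet_Ioc).2 (by simp))
    ((integrable_indicator_iff measurableSet_Ioc).2 (by simp)),
    integral_indicator_const _ measurableSet_Ioc, integral_indicator_const _ measurableSet_Ioc]
  rcases le_total a 0 with h | h <;> simp [h, abs_of_nonneg, abs_of_nonpos]

/-- The part of `E` outside a translate of `F` is at least as long as the difference of the
depths. -/
lemma ofReal_layerDepth_le_volume {E F : Set (ℝ × ℝ)} (hE : MeasurableSet E)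
    (hF : MeasurableSet F) {t s : ℝ} (hEi : Integrable fun x => layer E (t, x))
    (hFi : Integrable fun x => layer F (s, x)) (z : ℝ) :
    ENNReal.ofReal (layerDepth F s + z - layerDepth E t) ≤
      volume {x | (t, x) ∈ E ∧ (s, x - z) ∉ F} := by
  set D := {x | (t, x) ∈ E ∧ (s, x - z) ∉ F}
  have hm : MeasurableSet D := (measurable_prodMk_left hE).inter
    ((show Measurable fun x : ℝ => (s, x - z) by fun_prop) hF.compl)
  rcases eq_or_ne (volume D) ⊤ with hD | hD
  · simp [hD]
  have hFz : Integrable fun x => layer F (s, x - z) := hFi.comp_sub_right z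
  have hDi : Integrable (D.indicator fun _ => (1 : ℝ)) :=
    (integrable_indicator_iff hm).2 (by simpa using hD.lt_top)
  -- The step corrections cancel, so the left side is the indicator of the slice of `E` minus that
  -- of the translated slice of `F`, which is at most the indicator of `D`.
  have hle := integral_mono ((hEi.sub hFz).sub (integrable_unitStep_shift_sub z)) hDi (fun x => by
    by_cases h1 : (t, x) ∈ E <;> by_cases h2 : (s, x - z) ∈ F <;>
      simp [D, layer, h1, h2]; linarith)
  have hval : ∫ x, ((layer E (t, x) - layer F (s, x - z)) - (unitStep (x - z) - unitStep x)) =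
      layerDepth F s + z - layerDepth E t := by
    have h1 : Integrable fun x => layer E (t, x) - layer F (s, x - z) := hEi.sub hFz
    rw [integral_sub h1 (integrable_unitStep_shift_sub z), integral_sub hEi hFz,
      integral_sub_right_eq_self (fun x => layer F (s, x)), integral_unitStep_shift_sub]
    simp [layerDepth]; ring
  have hle' : layerDepth F s + z - layerDepth E t ≤ ∫ x, D.indicator (fun _ => (1 : ℝ)) x := by
    rw [← hval]; exact hle
  rw [integral_indicator_const _ hm] at hle'
  exact ENNReal.ofReal_le_of_le_toReal (by simpa [measureReal_def] using hle')

/-- Equality in `ofReal_layerDepth_le_volume` for half lines. -/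
lemma volume_halfLine_shift (a b z : ℝ) :
    volume {x : ℝ | a < x ∧ ¬ b < x - z} = ENNReal.ofReal (b + z - a) := by
  rw [← Real.volume_Ioc]
  congr 1
  ext x
  simp only [mem_ofPred_eq, mem_Ioc, not_lt, sub_le_iff_le_add]

/-! ### Decay of profiles and integrability. -/

lemma abs_le_of_rpow_mul_abs_le_one {s x y : ℝ} (hs : 0 ≤ s) (hx : 1 ≤ |x|)
    (h : |x| ^ s * |y| ≤ 1) : |y| ≤ 2 ^ s * (1 + ‖x‖) ^ (-s) := by
  have h0 : (0 : ℝ) < 1 + |x| := by positivity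
  rw [Real.norm_eq_abs, Real.rpow_neg h0.le, ← div_eq_mul_inv,
    le_div_iff₀ (Real.rpow_pos_of_pos h0 s)]
  calc |y| * (1 + |x|) ^ s ≤ |y| * (2 * |x|) ^ s := by
        gcongr
        linarith
    _ = 2 ^ s * (|x| ^ s * |y|) := by
        rw [Real.mul_rpow (by norm_num) (abs_nonneg x)]; ring
    _ ≤ 2 ^ s * 1 := by gcongr
    _ = 2 ^ s := mul_one _

lemma abs_sub_unitStep_le_one {y : ℝ} (hy : y ∈ Icc (0 : ℝ) 1) (x : ℝ) :
    |y - unitStep x| ≤ 1 := by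
  have h1 := hy.1
  have h2 := hy.2
  by_cases hx : 0 < x <;> simp [unitStep, hx, abs_le] <;> constructor <;> linarith

/-- The difference is bounded, and near both infinities it is dominated by a multiple of `(1 + |x|)
^ (-(1 + ε))`, which is integrable because the exponent exceeds the dimension. -/
lemma integrable_sub_unitStep {ε : ℝ} (hε : 0 < ε) {p : ℝ → ℝ} (hp : p ∈ profileSpace ε) :
    Integrable fun x => p x - unitStep x := by
  obtain ⟨hm, hI, hbot, htop⟩ := hp
  have hint : Integrable (fun x : ℝ => (1 + ‖x‖) ^ (-(1 + ε))) :=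
    integrable_one_add_norm (by simp [hε])
  have hloc : LocallyIntegrable (fun x => p x - unitStep x) :=
    (locallyIntegrable_const (1 : ℝ)).mono
      (hm.sub measurable_unitStep.aemeasurable).aestronglyMeasurable
      (Eventually.of_forall fun x => by simpa using abs_sub_unitStep_le_one (hI x) x)
  have hnorm : ∀ x : ℝ, ‖(1 + ‖x‖) ^ (-(1 + ε))‖ = (1 + ‖x‖) ^ (-(1 + ε)) := fun x =>
    Real.norm_of_nonneg (by positivity)
  refine hloc.integrable_of_isBigO_atBot_atTop (Asymptotics.IsBigO.of_bound (2 ^ (1 + ε)) ?_)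
    ⟨univ, univ_mem, hint.integrableOn⟩ (Asymptotics.IsBigO.of_bound (2 ^ (1 + ε)) ?_)
    ⟨univ, univ_mem, hint.integrableOn⟩
  · filter_upwards [hbot.abs.eventually (gt_mem_nhds (show |(0 : ℝ)| < 1 by simp)),
      eventually_le_atBot (-1)] with x hx hx1
    rw [hnorm]
    refine abs_le_of_rpow_mul_abs_le_one (by positivity) (by rw [abs_of_neg] <;> linarith) ?_
    have : unitStep x = 0 := by simp [unitStep]; linarith
    rw [abs_mul, abs_of_nonneg (Real.rpow_nonneg (abs_nonneg x) _)] at hx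
    rw [this, sub_zero]
    exact hx.le
  · filter_upwards [htop.abs.eventually (gt_mem_nhds (show |(0 : ℝ)| < 1 by simp)),
      eventually_ge_atTop 1] with x hx hx1
    rw [hnorm]
    refine abs_le_of_rpow_mul_abs_le_one (by positivity) (by rw [abs_of_pos] <;> linarith) ?_
    have : unitStep x = 1 := by simp [unitStep]; linarith
    rw [abs_mul, abs_of_nonneg (Real.rpow_nonneg (abs_nonneg x) _)] at hx
    rw [this]
    exact hx.le

lemma tendsto_zero_of_rpow_mul {ε : ℝ} (hε : 0 < ε) {l : Filter ℝ} {q : ℝ → ℝ}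
    (hl : ∀ᶠ x in l, 1 ≤ |x|) (h : Tendsto (fun x : ℝ => |x| ^ (1 + ε) * q x) l (𝓝 0)) :
    Tendsto q l (𝓝 0) := by
  refine squeeze_zero_norm' ?_ (by simpa using h.abs)
  filter_upwards [hl] with x hx
  rw [Real.norm_eq_abs]
  exact le_mul_of_one_le_left (abs_nonneg _)
    ((Real.one_le_rpow hx (by positivity)).trans (le_abs_self _))

/-! ### Level sets and the increasing rearrangement. -/

/-- Level sets of a profile split into a bounded set and a half line. -/
lemma exists_levelSet_eq {ε : ℝ} (hε : 0 < ε) {p : ℝ → ℝ} (hp : p ∈ profileSpace ε) {t : ℝ}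
    (ht : t ∈ Ioo (0 : ℝ) 1) :
    ∃ (A : Set ℝ) (a : ℝ), Bornology.IsBounded A ∧ Disjoint A (Ioi a) ∧
      levelSet p t = A ∪ Ioi a := by
  obtain ⟨-, -, hbot, htop⟩ := hp
  have h0 : Tendsto p atBot (𝓝 0) := tendsto_zero_of_rpow_mul hε
    (by filter_upwards [eventually_le_atBot (-1)] with x hx using by
          rw [abs_of_neg] <;> linarith) hbot
  have h1 : Tendsto (fun x => p x - 1) atTop (𝓝 0) := tendsto_zero_of_rpow_mul hε
    (by filter_upwards [eventually_ge_atTop 1] with x hx using hx.trans (le_abs_self x)) htop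
  obtain ⟨c, hc⟩ := eventually_atBot.1 (h0.eventually (gt_mem_nhds ht.1))
  obtain ⟨a, ha⟩ := eventually_atTop.1
    (h1.eventually (lt_mem_nhds (show t - 1 < 0 by linarith [ht.2])))
  refine ⟨levelSet p t ∩ Iic a, a, (Metric.isBounded_Icc c a).subset ?_, ?_, ?_⟩
  · rintro x ⟨hx, hxa⟩
    refine ⟨le_of_not_gt fun hxc => ?_, hxa⟩
    exact absurd (hc x hxc.le) (not_lt.2 (le_of_lt hx))
  · exact disjoint_left.2 fun x hx hx' => (mem_Ioi.1 hx').not_ge hx.2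
  · ext x
    constructor
    · intro hx
      rcases le_or_gt x a with h | h
      exacts [Or.inl ⟨hx, h⟩, Or.inr h]
    · rintro (hx | hx)
      · exact hx.1
      · have := ha x (le_of_lt hx)
        change t < p x
        linarith

/-- The left side of the integral identity does not mention `A` or `a`; this is why the end point `a
- |A|` is independent of the decomposition. Profiles are only Lebesgue measurable, hence the null
measurable sets. -/
lemma levelSet_indicator_sub_unitStep {p : ℝ → ℝ} (hp : AEMeasurable p) {t : ℝ} {A : Set ℝ}
    {a : ℝ} (hA : Bornology.IsBounded A) (hd : Disjoint A (Ioi a))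
    (h : levelSet p t = A ∪ Ioi a) :
    Integrable (fun x => (levelSet p t).indicator (fun _ => (1 : ℝ)) x - unitStep x) ∧
      ∫ x, ((levelSet p t).indicator (fun _ => (1 : ℝ)) x - unitStep x) =
        (volume A).toReal - a := by
  have hE : NullMeasurableSet (levelSet p t) := nullMeasurableSet_lt aemeasurable_const hp
  have hAm : NullMeasurableSet A := by
    have : A = levelSet p t \ Ioi a := by
      rw [h, union_sdiff_right, hd.sdiff_eq_left]
    rw [this]
    exact hE.diff measurableSet_Ioi.nullMeasurableSet
  have hAf : volume A < ⊤ := hA.measure_lt_top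
  have hAi : Integrable (A.indicator fun _ => (1 : ℝ)) :=
    IntegrableOn.integrable_indicator₀ (by simpa using hAf) hAm
  have heq : (fun x => (levelSet p t).indicator (fun _ => (1 : ℝ)) x - unitStep x) =
      fun x => A.indicator (fun _ => (1 : ℝ)) x + (unitStep (x - a) - unitStep x) := by
    ext x
    rw [h, indicator_union_of_disjoint hd, unitStep_shift_eq]
    ring
  rw [heq]
  refine ⟨hAi.add (integrable_unitStep_shift_sub a), ?_⟩
  rw [integral_add hAi (integrable_unitStep_shift_sub a), integral_unitStep_shift_sub,
    integral_indicator₀ hAm]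
  simp [measureReal_def, sub_eq_add_neg]

/-- The end point of the rearranged level set. -/
def levelDepth (p : ℝ → ℝ) (t : ℝ) : ℝ :=
  -∫ x, ((levelSet p t).indicator (fun _ => (1 : ℝ)) x - unitStep x)

lemma rearrangedLevelSet_eq_Ioi {ε : ℝ} (hε : 0 < ε) {p : ℝ → ℝ} (hp : p ∈ profileSpace ε)
    {t : ℝ} (ht : t ∈ Ioo (0 : ℝ) 1) : rearrangedLevelSet p t = Ioi (levelDepth p t) := by
  have key : ∀ (A : Set ℝ) (a : ℝ), Bornology.IsBounded A → Disjoint A (Ioi a) →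
      levelSet p t = A ∪ Ioi a → levelDepth p t = a - (volume A).toReal := by
    intro A a h1 h2 h3
    rw [levelDepth, (levelSet_indicator_sub_unitStep hp.1 h1 h2 h3).2]
    ring
  ext x
  constructor
  · rintro ⟨A, a, h1, h2, h3, h4⟩
    rwa [mem_Ioi, key A a h1 h2 h3]
  · intro hx
    obtain ⟨A, a, h1, h2, h3⟩ := exists_levelSet_eq hε hp ht
    exact ⟨A, a, h1, h2, h3, by rwa [mem_Ioi, key A a h1 h2 h3] at hx⟩

lemma rearrangedLevelSet_eq_empty {p : ℝ → ℝ} (hp : ∀ x, p x ≤ 1) {t : ℝ} (ht : 1 ≤ t) :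
    rearrangedLevelSet p t = ∅ := by
  refine eq_empty_of_forall_notMem ?_
  rintro x ⟨A, a, -, -, h, -⟩
  have : a + 1 ∈ levelSet p t := by rw [h]; right; simp
  have h1 : t < p (a + 1) := this
  linarith [hp (a + 1)]

lemma levelDepth_monotoneOn {ε : ℝ} (hε : 0 < ε) {p : ℝ → ℝ} (hp : p ∈ profileSpace ε) :
    MonotoneOn (levelDepth p) (Ioo 0 1) := by
  intro s hs t ht hst
  obtain ⟨A, a, h1, h2, h3⟩ := exists_levelSet_eq hε hp hs
  obtain ⟨B, b, k1, k2, k3⟩ := exists_levelSet_eq hε hp ht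
  refine neg_le_neg (integral_mono (levelSet_indicator_sub_unitStep hp.1 k1 k2 k3).1
    (levelSet_indicator_sub_unitStep hp.1 h1 h2 h3).1 fun x => ?_)
  refine sub_le_sub_right (indicator_le_indicator_of_subset (fun y hy => ?_)
    (fun _ => zero_le_one) x) _
  exact hst.trans_lt hy

lemma increasingRearrangement_eq {ε : ℝ} (hε : 0 < ε) {p : ℝ → ℝ} (hp : p ∈ profileSpace ε)
    (x : ℝ) : increasingRearrangement p x = volume.real {t ∈ Ioo (0 : ℝ) 1 | levelDepth p t < x} := by
  have hms : MeasurableSet {t ∈ Ioo (0 : ℝ) 1 | levelDepth p t < x} := by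
    -- Depths increase with the level, so this is an initial interval of levels.
    refine OrdConnected.measurableSet ⟨?_⟩
    rintro s ⟨hs, -⟩ t ⟨ht, htx⟩ u ⟨hsu, hut⟩
    have hu : u ∈ Ioo (0 : ℝ) 1 := ⟨hs.1.trans_le hsu, hut.trans_lt ht.2⟩
    exact ⟨hu, (levelDepth_monotoneOn hε hp hu ht hut).trans_lt htx⟩
  have : ∀ t ∈ Ioi (0 : ℝ), (rearrangedLevelSet p t).indicator (fun _ => (1 : ℝ)) x =
      {t ∈ Ioo (0 : ℝ) 1 | levelDepth p t < x}.indicator (fun _ => (1 : ℝ)) t := by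
    intro t ht
    rcases lt_or_ge t 1 with h | h
    · simp [rearrangedLevelSet_eq_Ioi hε hp ⟨ht, h⟩, indicator, mem_Ioi.1 ht, h]
    · simp [rearrangedLevelSet_eq_empty (fun x => (hp.2.1 x).2) h, indicator, not_lt.2 h]
  rw [increasingRearrangement, setIntegral_congr_fun measurableSet_Ioi this,
    setIntegral_indicator hms]
  have h2 : Ioi 0 ∩ {t ∈ Ioo (0 : ℝ) 1 | levelDepth p t < x} =
      {t ∈ Ioo (0 : ℝ) 1 | levelDepth p t < x} :=
    inter_eq_right.2 fun t ht => ht.1.1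
  rw [h2]
  simp

lemma increasingRearrangement_mem_Icc {ε : ℝ} (hε : 0 < ε) {p : ℝ → ℝ}
    (hp : p ∈ profileSpace ε) (x : ℝ) : increasingRearrangement p x ∈ Icc (0 : ℝ) 1 := by
  rw [increasingRearrangement_eq hε hp]
  refine ⟨measureReal_nonneg, ?_⟩
  calc _ ≤ volume.real (Ioo (0 : ℝ) 1) := measureReal_mono (fun t ht => ht.1) (by simp)
    _ = 1 := by simp

/-- The levels of depth below `x` form an initial interval of `Ioo 0 1` whose length is the
rearrangement at `x`. Only its end point may go either way, and that level is excluded. -/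
lemma levelDepth_lt_iff {ε : ℝ} (hε : 0 < ε) {p : ℝ → ℝ} (hp : p ∈ profileSpace ε) {t x : ℝ}
    (ht : t ∈ Ioo (0 : ℝ) 1) (hne : t ≠ increasingRearrangement p x) :
    levelDepth p t < x ↔ t < increasingRearrangement p x := by
  have hmono := levelDepth_monotoneOn hε hp
  constructor
  · intro h
    refine lt_of_le_of_ne ?_ hne
    rw [increasingRearrangement_eq hε hp]
    calc t = volume.real (Ioc 0 t) := by simp [ht.1.le]
      _ ≤ _ := by
        refine measureReal_mono (fun s hs => ?_)
          (measure_ne_top_of_subset (fun s hs => hs.1) (by simp : volume (Ioo (0 : ℝ) 1) ≠ ⊤))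
        have hs' : s ∈ Ioo (0 : ℝ) 1 := ⟨hs.1, hs.2.trans_lt ht.2⟩
        exact ⟨hs', (hmono hs' ht hs.2).trans_lt h⟩
  · intro h
    by_contra! hx
    refine absurd h (not_lt.2 ?_)
    rw [increasingRearrangement_eq hε hp]
    calc _ ≤ volume.real (Ioo 0 t) := by
          refine measureReal_mono (fun s hs => ⟨hs.1.1, ?_⟩) (by simp)
          by_contra! hts
          exact absurd hs.2 (not_lt.2 (hx.trans (hmono ht hs.1 hts)))
      _ = t := by simp [ht.1.le]

/-! ### Layered sets of a profile and of its rearrangement. -/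

/-- The half lines with the same depths as the layers of `E`. -/
def halfLines (E : Set (ℝ × ℝ)) : Set (ℝ × ℝ) := {z | layerDepth E z.1 < z.2}

lemma measurableSet_halfLines {E : Set (ℝ × ℝ)} (hE : MeasurableSet E) :
    MeasurableSet (halfLines E) :=
  measurableSet_lt ((measurable_layerDepth hE).comp measurable_fst) measurable_snd

lemma layer_halfLines (E : Set (ℝ × ℝ)) (t x : ℝ) :
    layer (halfLines E) (t, x) = unitStep (x - layerDepth E t) - unitStep x := by
  by_cases h : layerDepth E t < x <;> simp [unitStep_shift_eq, layer, halfLines, h]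

lemma layerDepth_halfLines (E : Set (ℝ × ℝ)) (t : ℝ) :
    layerDepth (halfLines E) t = layerDepth E t := by
  rw [layerDepth]
  simp only [layer_halfLines, integral_unitStep_shift_sub, neg_neg]

/-- A half line differs from the unit step by a set of length `|depth|`, and the depth is an
integrable function of the level by Fubini. -/
lemma integrable_layer_halfLines {E : Set (ℝ × ℝ)} (hE : MeasurableSet E)
    (hi : Integrable (layer E) (levelMeasure.prod volume)) :
    Integrable (layer (halfLines E)) (levelMeasure.prod volume) := by
  rw [integrable_prod_iff
    (measurable_layer (measurableSet_halfLines hE)).aestronglyMeasurable]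
  simp only [layer_halfLines, integral_abs_unitStep_shift_sub]
  exact ⟨Eventually.of_forall fun t => integrable_unitStep_shift_sub _,
    hi.integral_prod_left.neg.abs⟩

/-- A layer is non-negative up to the origin and non-positive beyond it, so its sign depends on the
position alone. -/
lemma norm_layer (E : Set (ℝ × ℝ)) (z : ℝ × ℝ) :
    ‖layer E z‖ = (1 - 2 * unitStep z.2) * layer E z := by
  by_cases h1 : z ∈ E <;> by_cases h2 : 0 < z.2 <;> simp [layer, unitStep, h1, h2]
  all_goals norm_num

lemma integrable_layer_subgraph {p p₀ : ℝ → ℝ} (hp : ∀ x, p x ∈ Icc (0 : ℝ) 1)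
    (hm : Measurable p₀) (he : p =ᵐ[volume] p₀)
    (hi : Integrable fun x => p x - unitStep x) :
    Integrable (layer {z : ℝ × ℝ | z.1 < p₀ z.2}) (levelMeasure.prod volume) := by
  have hE : MeasurableSet {z : ℝ × ℝ | z.1 < p₀ z.2} :=
    measurableSet_lt measurable_fst (hm.comp measurable_snd)
  have hsec : ∀ x, Integrable (fun t => layer {z : ℝ × ℝ | z.1 < p₀ z.2} (t, x)) levelMeasure := by
    intro x
    refine Integrable.of_bound
      ((measurable_layer hE).comp measurable_prodMk_right).aestronglyMeasurable 1
      (Eventually.of_forall fun t => ?_)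
    by_cases h1 : t < p₀ x <;> by_cases h2 : 0 < x <;> simp [layer, unitStep, h1, h2]
  rw [integrable_prod_iff' (measurable_layer hE).aestronglyMeasurable]
  refine ⟨Eventually.of_forall hsec, hi.abs.congr ?_⟩
  filter_upwards [he] with x hx
  simp only [norm_layer]
  rw [integral_const_mul]
  have h1 : (fun t => layer {z : ℝ × ℝ | z.1 < p₀ z.2} (t, x)) =
      fun t => (Iio (p x)).indicator (fun _ => (1 : ℝ)) t - unitStep x := by
    ext t
    simp [layer, indicator, hx]
  rw [h1, integral_sub ((integrable_const _).indicator measurableSet_Iio) (integrable_const _),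
    ← intervalIntegral_eq_integral_levelMeasure _ (hp x)]
  have hx0 := (hp x).1
  have hx1 := (hp x).2
  by_cases h2 : 0 < x
  · have : p x - 1 ≤ 0 := by linarith
    simp [unitStep, h2, abs_of_nonpos this]; ring
  · simp [unitStep, h2, abs_of_nonneg hx0]

/-- A profile and its increasing rearrangement are layered by sets with the same depths. -/
lemma exists_isLayered {ε : ℝ} (hε : 0 < ε) {p : ℝ → ℝ} (hp : p ∈ profileSpace ε) :
    ∃ E, IsLayered E p ∧ IsLayered (halfLines E) (increasingRearrangement p) := by
  have hm := hp.1.measurable_mk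
  have he := hp.1.ae_eq_mk
  set p₀ := hp.1.mk p
  have hE : MeasurableSet {z : ℝ × ℝ | z.1 < p₀ z.2} :=
    measurableSet_lt measurable_fst (hm.comp measurable_snd)
  have hi := integrable_layer_subgraph hp.2.1 hm he (integrable_sub_unitStep hε hp)
  -- Replacing `p` by its measurable representative changes level sets by null sets, so every depth
  -- is kept.
  have hdepth : ∀ t, layerDepth {z : ℝ × ℝ | z.1 < p₀ z.2} t = levelDepth p t := by
    intro t
    refine congrArg Neg.neg (integral_congr_ae ?_)
    filter_upwards [he] with x hx
    simp [layer, levelSet, indicator, hx]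
  refine ⟨{z | z.1 < p₀ z.2}, ⟨hE, ?_, hp.2.1, hi⟩, measurableSet_halfLines hE, ?_,
    increasingRearrangement_mem_Icc hε hp, integrable_layer_halfLines hE hi⟩
  · filter_upwards [he] with x hx
    simp [hx]
  · refine Eventually.of_forall fun x => ?_
    have hne : ∀ᵐ t ∂(volume : Measure ℝ), t ≠ increasingRearrangement p x := by simp [ae_iff]
    filter_upwards [ae_restrict_of_ae hne, ae_restrict_mem measurableSet_Ioo] with t h1 h2
    change layerDepth {z : ℝ × ℝ | z.1 < p₀ z.2} t < x ↔ _
    rw [hdepth]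
    exact levelDepth_lt_iff hε hp h2 h1

/-! ### Generalized inverses. -/

section GenInv

variable {h : ℝ → ℝ}

lemma bddBelow_genInv_set (h : ℝ → ℝ) (u : ℝ) :
    BddBelow {v : ℝ | v ∈ Icc (0 : ℝ) 1 ∧ u ≤ h v} := ⟨0, fun _ hv => hv.1.1⟩

lemma genInv_le {u v : ℝ} (hv : v ∈ Icc (0 : ℝ) 1) (huv : u ≤ h v) : genInv h u ≤ v :=
  csInf_le (bddBelow_genInv_set h u) ⟨hv, huv⟩

lemma IsUpdateFunction.genInv_mem_Icc (hh : IsUpdateFunction h) {u : ℝ} (hu : u ≤ 1) :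
    genInv h u ∈ Icc (0 : ℝ) 1 := by
  have h1 : (1 : ℝ) ∈ Icc (0 : ℝ) 1 := ⟨zero_le_one, le_rfl⟩
  have h2 : u ≤ h 1 := by rwa [hh.map_one]
  exact ⟨le_csInf ⟨1, h1, h2⟩ fun v hv => hv.1.1, genInv_le h1 h2⟩

lemma IsUpdateFunction.le_of_genInv_lt (hh : IsUpdateFunction h) {u v : ℝ} (hu : u ≤ 1)
    (hv : v ∈ Icc (0 : ℝ) 1) (huv : genInv h u < v) : u ≤ h v := by
  have hne : {v : ℝ | v ∈ Icc (0 : ℝ) 1 ∧ u ≤ h v}.Nonempty :=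
    ⟨1, ⟨zero_le_one, le_rfl⟩, by rwa [hh.map_one]⟩
  obtain ⟨v', ⟨h1, h2⟩, h3⟩ := exists_lt_of_csInf_lt hne huv
  exact h2.trans (hh.monotoneOn h1 hv h3.le)

lemma IsUpdateFunction.genInv_monotoneOn (hh : IsUpdateFunction h) :
    MonotoneOn (genInv h) (Icc 0 1) := by
  intro u _ v hv huv
  exact csInf_le_csInf (bddBelow_genInv_set h u)
    ⟨1, ⟨zero_le_one, le_rfl⟩, by rw [hh.map_one]; exact hv.2⟩ fun x hx => ⟨hx.1, huv.trans hx.2⟩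

lemma MonotoneOn.aestronglyMeasurable_levelMeasure {k : ℝ → ℝ} (hk : MonotoneOn k (Icc 0 1)) :
    AEStronglyMeasurable k levelMeasure :=
  (aemeasurable_restrict_of_monotoneOn measurableSet_Ioo
    (hk.mono Ioo_subset_Icc_self)).aestronglyMeasurable

lemma intervalIntegrable_of_monotoneOn_Icc {k : ℝ → ℝ} (hk : MonotoneOn k (Icc 0 1)) {q : ℝ}
    (hq : q ∈ Icc (0 : ℝ) 1) : IntervalIntegrable k volume 0 q := by
  refine MonotoneOn.intervalIntegrable (hk.mono ?_)
  rw [uIcc_of_le hq.1]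
  exact Icc_subset_Icc_right hq.2

lemma ae_levelMeasure_mem : ∀ᵐ t ∂levelMeasure, t ∈ Ioo (0 : ℝ) 1 :=
  ae_restrict_mem measurableSet_Ioo

lemma ae_levelMeasure_ne (c : ℝ) : ∀ᵐ t ∂levelMeasure, t ≠ c :=
  ae_restrict_of_ae (by simp [ae_iff])

/-- The areas below an update function and below its generalized inverse add up to one. -/
lemma IsUpdateFunction.integral_genInv (hh : IsUpdateFunction h) :
    ∫ u in (0 : ℝ)..1, genInv h u = 1 - ∫ v in (0 : ℝ)..1, h v := by
  have hm : AEStronglyMeasurable h levelMeasure :=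
    MonotoneOn.aestronglyMeasurable_levelMeasure hh.monotoneOn
  have hb : ∀ᵐ v ∂levelMeasure, ‖h v‖ ≤ 1 := by
    filter_upwards [ae_levelMeasure_mem] with v hv
    have := hh.mapsTo (Ioo_subset_Icc_self hv)
    rw [Real.norm_of_nonneg this.1]
    exact this.2
  have hhi : Integrable h levelMeasure := Integrable.of_bound hm 1 hb
  have hS : NullMeasurableSet {z : ℝ × ℝ | h z.2 < z.1} (levelMeasure.prod levelMeasure) :=
    nullMeasurableSet_lt hm.aemeasurable.comp_snd measurable_fst.aemeasurable
  have hi : Integrable ({z : ℝ × ℝ | h z.2 < z.1}.indicator fun _ => (1 : ℝ))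
      (levelMeasure.prod levelMeasure) :=
    IntegrableOn.integrable_indicator₀ (by simp) hS
  rw [intervalIntegral_one_eq_integral_levelMeasure, intervalIntegral_one_eq_integral_levelMeasure]
  -- Both sides are the area of the region `h v < u` of the unit square, sliced in the two
  -- directions.
  calc ∫ u, genInv h u ∂levelMeasure
      = ∫ u, ∫ v, {z : ℝ × ℝ | h z.2 < z.1}.indicator (fun _ => (1 : ℝ)) (u, v)
          ∂levelMeasure ∂levelMeasure := by
        refine integral_congr_ae ?_
        filter_upwards [ae_levelMeasure_mem] with u hu
        have h1 := intervalIntegral_eq_integral_levelMeasure (fun _ => 1)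
          (hh.genInv_mem_Icc hu.2.le)
        rw [intervalIntegral.integral_const, sub_zero, smul_eq_mul, mul_one] at h1
        rw [h1]
        refine integral_congr_ae ?_
        filter_upwards [ae_levelMeasure_mem, ae_levelMeasure_ne (genInv h u)] with v hv hne
        have hv' := Ioo_subset_Icc_self hv
        -- Without continuity of `h` the infimum need not be attained; the null set `v = genInv h u`
        -- has been removed for this reason.
        have : v < genInv h u ↔ h v < u := by
          constructor
          · intro hlt
            by_contra! hle
            exact absurd (genInv_le hv' hle) (not_le.2 hlt)
          · intro hlt
            by_contra! hle
            exact absurd (hh.le_of_genInv_lt hu.2.le hv' (lt_of_le_of_ne hle hne.symm))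
              (not_le.2 hlt)
        by_cases hlt : h v < u
        · simp [hlt, this.2 hlt]
        · simp [hlt, mt this.1 hlt]
    _ = ∫ v, ∫ u, {z : ℝ × ℝ | h z.2 < z.1}.indicator (fun _ => (1 : ℝ)) (u, v)
          ∂levelMeasure ∂levelMeasure := integral_integral_swap hi
    _ = ∫ v, (1 - h v) ∂levelMeasure := by
        refine integral_congr_ae ?_
        filter_upwards [ae_levelMeasure_mem] with v hv
        have hr := hh.mapsTo (Ioo_subset_Icc_self hv)
        have h1 : (fun u => {z : ℝ × ℝ | h z.2 < z.1}.indicator (fun _ => (1 : ℝ)) (u, v)) =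
            (Ioi (h v)).indicator fun _ => 1 := by
          ext u
          by_cases hu : h v < u <;> simp [hu]
        have h2 : Ioi (h v) ∩ Ioo 0 1 = Ioo (h v) 1 := by
          ext u
          exact ⟨fun hu => ⟨hu.1, hu.2.2⟩, fun hu => ⟨hu.1, hr.1.trans_lt hu.1, hu.2⟩⟩
        rw [h1, integral_indicator_const _ measurableSet_Ioi, levelMeasure, measureReal_def,
          Measure.restrict_apply measurableSet_Ioi, h2]
        simp [hr.2]
    _ = _ := by
        rw [integral_sub (integrable_const _) hhi]
        simp

lemma IsUpdateFunction.norm_genInv_sub_le (hh : IsUpdateFunction h) {c : ℝ}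
    (hc : c ∈ Icc (0 : ℝ) 1) : ∀ᵐ t ∂levelMeasure, ‖genInv h t - c‖ ≤ 1 := by
  filter_upwards [ae_levelMeasure_mem] with t ht
  have := hh.genInv_mem_Icc ht.2.le
  rw [Real.norm_eq_abs, abs_le]
  constructor <;> linarith [this.1, this.2, hc.1, hc.2]

end GenInv

/-! ### Splitting the potential. -/

/-- The integrable part of the integrand of the potential. -/
def localPart (hf hg f g : ℝ → ℝ) (x : ℝ) : ℝ :=
  relativePrimitive (fun u => genInv hg u - 0) g x + relativePrimitive (fun u => genInv hf u - 1) f x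

/-- The non-negative part of the integrand of the potential. -/
def interaction (w f g : ℝ → ℝ) (x : ℝ) : ℝ := f x * (1 - conv g w x)

/-- The constant `1` subtracted in the primitive at `f` produces `-f`, which the interaction gives
back. The multiples of the unit step then cancel exactly because the two inverses have total
integral one. -/
lemma potentialIntegrand_eq {hf hg : ℝ → ℝ} (hhf : IsUpdateFunction hf)
    (hhg : IsUpdateFunction hg) (hA : signedArea hf hg 1 = 0) (w : ℝ → ℝ) {f g : ℝ → ℝ}
    (hf01 : ∀ x, f x ∈ Icc (0 : ℝ) 1) (x : ℝ) :
    potentialIntegrand hf hg w f g x = localPart hf hg f g x + interaction w f g x := by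
  have h1 : (1 : ℝ) ∈ Icc (0 : ℝ) 1 := ⟨zero_le_one, le_rfl⟩
  have hsum : (∫ u in (0 : ℝ)..1, genInv hg u) + ∫ u in (0 : ℝ)..1, genInv hf u = 1 := by
    rw [signedArea, intervalIntegral.integral_sub
      (intervalIntegrable_of_monotoneOn_Icc hhg.genInv_monotoneOn h1)
      (intervalIntegrable_of_monotoneOn_Icc hhf.monotoneOn h1)] at hA
    rw [hhf.integral_genInv]
    linarith
  simp only [potentialIntegrand, singleTerm, localPart, interaction, relativePrimitive, sub_zero]
  rw [intervalIntegral.integral_sub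
      (intervalIntegrable_of_monotoneOn_Icc hhf.genInv_monotoneOn (hf01 x)) (by simp),
    intervalIntegral.integral_sub
      (intervalIntegrable_of_monotoneOn_Icc hhf.genInv_monotoneOn h1) (by simp)]
  simp only [intervalIntegral.integral_const, smul_eq_mul]
  linear_combination (unitStep x) * hsum

section Local

variable {hf hg f g : ℝ → ℝ} {E F : Set (ℝ × ℝ)}

lemma IsUpdateFunction.aestronglyMeasurable_genInv_sub {h : ℝ → ℝ} (hh : IsUpdateFunction h)
    (c : ℝ) : AEStronglyMeasurable (fun u => genInv h u - c) levelMeasure :=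
  (MonotoneOn.aestronglyMeasurable_levelMeasure hh.genInv_monotoneOn).sub
    aestronglyMeasurable_const

lemma integrable_localPart (hhf : IsUpdateFunction hf) (hhg : IsUpdateFunction hg)
    (hE : IsLayered E f) (hF : IsLayered F g) : Integrable (localPart hf hg f g) :=
  (hF.integrable_relativePrimitive (hhg.aestronglyMeasurable_genInv_sub 0)
    (hhg.norm_genInv_sub_le (by simp))).add
  (hE.integrable_relativePrimitive (hhf.aestronglyMeasurable_genInv_sub 1)
    (hhf.norm_genInv_sub_le (by simp)))

lemma integral_localPart (hhf : IsUpdateFunction hf) (hhg : IsUpdateFunction hg)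
    (hE : IsLayered E f) (hF : IsLayered F g) : ∫ x, localPart hf hg f g x =
      -(∫ t, (genInv hg t - 0) * layerDepth F t ∂levelMeasure) +
      -∫ t, (genInv hf t - 1) * layerDepth E t ∂levelMeasure := by
  simp only [localPart]
  rw [integral_add (hF.integrable_relativePrimitive (hhg.aestronglyMeasurable_genInv_sub 0)
      (hhg.norm_genInv_sub_le (by simp)))
    (hE.integrable_relativePrimitive (hhf.aestronglyMeasurable_genInv_sub 1)
      (hhf.norm_genInv_sub_le (by simp))),
    hF.integral_relativePrimitive (hhg.aestronglyMeasurable_genInv_sub 0)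
      (hhg.norm_genInv_sub_le (by simp)),
    hE.integral_relativePrimitive (hhf.aestronglyMeasurable_genInv_sub 1)
      (hhf.norm_genInv_sub_le (by simp))]

end Local

/-! ### The interaction term. -/

section Interaction

variable {w f g : ℝ → ℝ}

lemma aestronglyMeasurable_shift_mul (hw : IsWindow w) (hg : AEMeasurable g) :
    AEStronglyMeasurable (fun z : ℝ × ℝ => g (z.1 - z.2) * w z.2) (volume.prod volume) := by
  have h1 : AEMeasurable (fun z : ℝ × ℝ => g (z.1 - z.2)) (volume.prod volume) :=
    hg.comp_quasiMeasurePreserving (quasiMeasurePreserving_sub volume volume)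
  exact h1.aestronglyMeasurable.mul hw.integrable.aestronglyMeasurable.comp_snd

lemma integrable_shift_mul (hw : IsWindow w) (hg : AEMeasurable g)
    (hg01 : ∀ x, g x ∈ Icc (0 : ℝ) 1) (x : ℝ) : Integrable fun z => g (x - z) * w z := by
  have h1 : AEMeasurable fun z => g (x - z) :=
    hg.comp_quasiMeasurePreserving (quasiMeasurePreserving_sub_left volume x)
  refine hw.integrable.bdd_mul (c := 1) h1.aestronglyMeasurable (Eventually.of_forall fun z => ?_)
  rw [Real.norm_of_nonneg (hg01 _).1]
  exact (hg01 _).2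

lemma one_sub_conv_eq (hw : IsWindow w) (hg : AEMeasurable g)
    (hg01 : ∀ x, g x ∈ Icc (0 : ℝ) 1) (x : ℝ) :
    1 - conv g w x = ∫ z, (w z - g (x - z) * w z) := by
  rw [integral_sub hw.integrable (integrable_shift_mul hw hg hg01 x), hw.integral_eq_one, conv,
    convolution_mul_swap]

lemma ofReal_one_sub_conv (hw : IsWindow w) (hg : AEMeasurable g)
    (hg01 : ∀ x, g x ∈ Icc (0 : ℝ) 1) (x : ℝ) :
    ENNReal.ofReal (1 - conv g w x) =
      ∫⁻ z, ENNReal.ofReal (w z) * ENNReal.ofReal (1 - g (x - z)) := by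
  have heq : ∀ z, w z - g (x - z) * w z = w z * (1 - g (x - z)) := fun z => by ring
  have hi : Integrable fun z => w z - g (x - z) * w z :=
    hw.integrable.sub (integrable_shift_mul hw hg hg01 x)
  rw [one_sub_conv_eq hw hg hg01, ofReal_integral_eq_lintegral_ofReal hi]
  · refine lintegral_congr fun z => ?_
    rw [heq, ENNReal.ofReal_mul (hw.nonneg z)]
  · refine Eventually.of_forall fun z => ?_
    simp only [heq]
    exact mul_nonneg (hw.nonneg z) (sub_nonneg.2 (hg01 _).2)

lemma interaction_nonneg (hw : IsWindow w) (hg : AEMeasurable g)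
    (hf01 : ∀ x, f x ∈ Icc (0 : ℝ) 1) (hg01 : ∀ x, g x ∈ Icc (0 : ℝ) 1) (x : ℝ) :
    0 ≤ interaction w f g x := by
  refine mul_nonneg (hf01 x).1 ?_
  rw [one_sub_conv_eq hw hg hg01]
  refine integral_nonneg fun z => ?_
  have heq : w z - g (x - z) * w z = w z * (1 - g (x - z)) := by ring
  simp only [heq]
  exact mul_nonneg (hw.nonneg z) (sub_nonneg.2 (hg01 _).2)

lemma aestronglyMeasurable_interaction (hw : IsWindow w) (hf : AEMeasurable f)
    (hg : AEMeasurable g) : AEStronglyMeasurable (interaction w f g) := by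
  have h1 : AEStronglyMeasurable fun x => ∫ z, g (x - z) * w z :=
    (aestronglyMeasurable_shift_mul hw hg).integral_prod_right'
  have h2 : (conv g w) = fun x => ∫ z, g (x - z) * w z := by
    ext x
    rw [conv, convolution_mul_swap]
  unfold interaction
  rw [h2]
  exact hf.aestronglyMeasurable.mul (aestronglyMeasurable_const.sub h1)

lemma lintegral_interaction (hw : IsWindow w) (hf : AEMeasurable f) (hg : AEMeasurable g)
    (hf01 : ∀ x, f x ∈ Icc (0 : ℝ) 1) (hg01 : ∀ x, g x ∈ Icc (0 : ℝ) 1) :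
    ∫⁻ x, ENNReal.ofReal (interaction w f g x) =
      ∫⁻ z, ENNReal.ofReal (w z) *
        ∫⁻ x, ENNReal.ofReal (f x) * ENNReal.ofReal (1 - g (x - z)) := by
  have hwm : AEMeasurable fun z => ENNReal.ofReal (w z) :=
    hw.integrable.aestronglyMeasurable.aemeasurable.ennreal_ofReal
  have hgm : AEMeasurable (fun z : ℝ × ℝ => ENNReal.ofReal (1 - g (z.1 - z.2)))
      (volume.prod volume) :=
    (aemeasurable_const.sub
      (hg.comp_quasiMeasurePreserving (quasiMeasurePreserving_sub volume volume))).ennreal_ofReal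
  calc _ = ∫⁻ x, ∫⁻ z, ENNReal.ofReal (f x) *
        (ENNReal.ofReal (w z) * ENNReal.ofReal (1 - g (x - z))) := by
        refine lintegral_congr fun x => ?_
        rw [interaction, ENNReal.ofReal_mul (hf01 x).1, ofReal_one_sub_conv hw hg hg01,
          lintegral_const_mul' _ _ ENNReal.ofReal_ne_top]
    _ = ∫⁻ z, ∫⁻ x, ENNReal.ofReal (f x) *
        (ENNReal.ofReal (w z) * ENNReal.ofReal (1 - g (x - z))) := by
        refine lintegral_lintegral_swap ?_
        exact hf.ennreal_ofReal.comp_fst.mul (hwm.comp_snd.mul hgm)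
    _ = _ := by
        refine lintegral_congr fun z => ?_
        rw [← lintegral_const_mul' _ _ ENNReal.ofReal_ne_top]
        exact lintegral_congr fun x => mul_left_comm _ _ _

end Interaction

/-- Rearranging both profiles does not increase the interaction. -/
lemma lintegral_interaction_halfLines_le {w f g f' g' : ℝ → ℝ} {E F : Set (ℝ × ℝ)}
    (hw : IsWindow w) (hE : IsLayered E f) (hF : IsLayered F g)
    (hE' : IsLayered (halfLines E) f') (hF' : IsLayered (halfLines F) g') :
    ∫⁻ x, ENNReal.ofReal (interaction w f' g' x) ≤
      ∫⁻ x, ENNReal.ofReal (interaction w f g x) := by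
  rw [lintegral_interaction hw hE.aemeasurable hF.aemeasurable hE.mem_Icc hF.mem_Icc,
    lintegral_interaction hw hE'.aemeasurable hF'.aemeasurable hE'.mem_Icc hF'.mem_Icc]
  -- The comparison holds for each shift `z` separately, before averaging over the window.
  refine lintegral_mono fun z => mul_le_mul_right ?_ _
  rw [lintegral_mul_one_sub_shift hE hF, lintegral_mul_one_sub_shift hE' hF']
  refine lintegral_mono_ae ?_
  -- Where a slice is not integrable, its depth is only the default value zero of the integral; such
  -- levels form a null set.
  filter_upwards [hE.integrable.prod_right_ae] with t ht
  refine lintegral_mono_ae ?_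
  filter_upwards [hF.integrable.prod_right_ae] with s hs
  refine le_trans (le_of_eq ?_)
    (ofReal_layerDepth_le_volume hE.measurableSet hF.measurableSet ht hs z)
  exact volume_halfLine_shift (layerDepth E t) (layerDepth F s) z

/-! ### The potential as an extended real number. -/

lemma lintegral_neg_add_lt_top {φ n : ℝ → ℝ} (hφ : Integrable φ) (hn : ∀ x, 0 ≤ n x) :
    ∫⁻ x, ENNReal.ofReal (-(φ x + n x)) < ⊤ := by
  refine lt_of_le_of_lt (lintegral_mono fun x => ENNReal.ofReal_le_ofReal ?_)
    (hφ.neg.lintegral_lt_top)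
  have := hn x
  simp only [Pi.neg_apply]
  linarith

/-- The extended integral of the sum of an integrable and a non-negative function. -/
lemma lintegral_pos_sub_lintegral_neg {φ n : ℝ → ℝ} (hφ : Integrable φ) (hn : ∀ x, 0 ≤ n x)
    (hnm : AEStronglyMeasurable n) :
    ((∫⁻ x, ENNReal.ofReal (φ x + n x) : ENNReal) : EReal) -
        ((∫⁻ x, ENNReal.ofReal (-(φ x + n x)) : ENNReal) : EReal) =
      ((∫ x, φ x : ℝ) : EReal) + ((∫⁻ x, ENNReal.ofReal (n x) : ENNReal) : EReal) := by
  have hneg := lintegral_neg_add_lt_top hφ hn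
  rcases eq_or_ne (∫⁻ x, ENNReal.ofReal (n x)) ⊤ with h | h
  -- Since `n` is at most the positive part of `φ + n` plus the negative part of `φ`, and the latter
  -- has finite integral, an infinite integral of `n` makes the positive part infinite too.
  · have hpos : ∫⁻ x, ENNReal.ofReal (φ x + n x) = ⊤ := by
      by_contra hne
      have hle : ∫⁻ x, ENNReal.ofReal (n x) ≤
          ∫⁻ x, ENNReal.ofReal (φ x + n x) + ENNReal.ofReal (-φ x) := by
        refine lintegral_mono fun x => ?_
        refine le_trans (le_of_eq ?_) ENNReal.ofReal_add_le
        congr 1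
        ring
      have hm : AEMeasurable fun x => ENNReal.ofReal (-φ x) := hφ.aemeasurable.neg.ennreal_ofReal
      rw [lintegral_add_right' _ hm, h] at hle
      exact (ENNReal.add_lt_top.2 ⟨lt_top_iff_ne_top.2 hne, hφ.neg.lintegral_lt_top⟩).ne
        (top_le_iff.1 hle)
    rw [hpos, h, EReal.coe_ennreal_top, EReal.coe_add_top]
    lift ∫⁻ x, ENNReal.ofReal (-(φ x + n x)) to NNReal using hneg.ne with r
    exact EReal.top_sub_coe r
  · have hni : Integrable n := by
      refine ⟨hnm, ?_⟩
      rw [hasFiniteIntegral_iff_ofReal (Eventually.of_forall hn)]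
      exact lt_top_iff_ne_top.2 h
    have hsum : Integrable fun x => φ x + n x := hφ.add hni
    have h1 := integral_eq_lintegral_pos_part_sub_lintegral_neg_part hsum
    rw [integral_add hφ hni,
      integral_eq_lintegral_of_nonneg_ae (Eventually.of_forall hn) hnm] at h1
    have hpos : ∫⁻ x, ENNReal.ofReal (φ x + n x) ≠ ⊤ := hsum.lintegral_lt_top.ne
    lift ∫⁻ x, ENNReal.ofReal (-(φ x + n x)) to NNReal using hneg.ne with r
    lift ∫⁻ x, ENNReal.ofReal (φ x + n x) to NNReal using hpos with s
    lift ∫⁻ x, ENNReal.ofReal (n x) to NNReal using h with q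
    simp only [ENNReal.coe_toReal] at h1
    change ((s : ℝ) : EReal) - ((r : ℝ) : EReal) = _ + ((q : ℝ) : EReal)
    exact_mod_cast h1.symm

lemma potentialNeg_lt_top {w hf hg f g : ℝ → ℝ} {E F : Set (ℝ × ℝ)} (hw : IsWindow w)
    (hhf : IsUpdateFunction hf) (hhg : IsUpdateFunction hg) (hA : signedArea hf hg 1 = 0)
    (hE : IsLayered E f) (hF : IsLayered F g) : potentialNeg hf hg w f g < ⊤ := by
  simp only [potentialNeg, potentialIntegrand_eq hhf hhg hA w hE.mem_Icc]
  exact lintegral_neg_add_lt_top (integrable_localPart hhf hhg hE hF)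
    (interaction_nonneg hw hF.aemeasurable hE.mem_Icc hF.mem_Icc)

lemma potential_eq {w hf hg f g : ℝ → ℝ} {E F : Set (ℝ × ℝ)} (hw : IsWindow w)
    (hhf : IsUpdateFunction hf) (hhg : IsUpdateFunction hg) (hA : signedArea hf hg 1 = 0)
    (hE : IsLayered E f) (hF : IsLayered F g) : potential hf hg w f g =
      ((∫ x, localPart hf hg f g x : ℝ) : EReal) +
        ((∫⁻ x, ENNReal.ofReal (interaction w f g x) : ENNReal) : EReal) := by
  simp only [potential, potentialPos, potentialNeg,
    potentialIntegrand_eq hhf hhg hA w hE.mem_Icc]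
  exact lintegral_pos_sub_lintegral_neg (integrable_localPart hhf hhg hE hF)
    (interaction_nonneg hw hF.aemeasurable hE.mem_Icc hF.mem_Icc)
    (aestronglyMeasurable_interaction hw hE.aemeasurable hF.aemeasurable)

end

end SpatialCoupling

theorem proposition1
    (w : ℝ → ℝ) (hw : IsWindow w) (hwsd : SymmetricDecreasing w)
    (hf hg : ℝ → ℝ) (hhf : IsUpdateFunction hf) (hhg : IsUpdateFunction hg)
    (hA : signedArea hf hg 1 = 0)
    (ε : ℝ) (hε : 0 < ε)
    (f g : ℝ → ℝ) (hfS : f ∈ profileSpace ε) (hgS : g ∈ profileSpace ε) :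
    potentialNeg hf hg w f g < ⊤ ∧
    potentialNeg hf hg w (increasingRearrangement f) (increasingRearrangement g) < ⊤ ∧
    potential hf hg w f g ≥
      potential hf hg w (increasingRearrangement f) (increasingRearrangement g) := by
  obtain ⟨E, hE, hE'⟩ := exists_isLayered hε hfS
  obtain ⟨F, hF, hF'⟩ := exists_isLayered hε hgS
  refine ⟨potentialNeg_lt_top hw hhf hhg hA hE hF, potentialNeg_lt_top hw hhf hhg hA hE' hF', ?_⟩
  rw [potential_eq hw hhf hhg hA hE hF, potential_eq hw hhf hhg hA hE' hF',
    integral_localPart hhf hhg hE hF, integral_localPart hhf hhg hE' hF']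
  -- The local terms now coincide, and only the interactions remain to be compared.
  simp only [layerDepth_halfLines]
  exact add_le_add_right
    (EReal.coe_ennreal_le_coe_ennreal_iff.2 (lintegral_interaction_halfLines_le hw hE hF hE' hF')) _
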